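/- Let $k$ be a field, $A$ a finite-dimensional $k$-algebra, and $\operatorname{mod} A$ the category of finite-dimensional left $A$-modules. For $M\in\operatorname{mod}A$ with minimal projective presentation $P_1\xrightarrow{d}P_0\to M\to 0$, let $\tau M=\operatorname{Hom}_k(\operatorname{Coker}\operatorname{Hom}_A(d,A),k)$ be its Auslander–Reiten translate. $M$ is called $\tau$-tilting if $\operatorname{Hom}_A(M,\tau M)=0$ and the number of isomorphism classes of indecomposable direct summands of $M$ equals the number of isomorphism classes of simple $A$-modules; $M$ is called support $\tau$-tilting if there is an idempotent $e\in A$ such that $M$ is a $\tau$-tilting $A/AeA$-module (with $\tau$ taken over $A/AeA$). Let $\operatorname{Gen}T$ be the full subcategory of $\operatorname{mod}A$ of all quotients of finite direct sums of copies of $T$, and for a full subcategory $\mathcal X$ let ${}^{\perp_1}\mathcal X=\{Y\in\operatorname{mod}A\mid \operatorname{Ext}^1_A(Y,X)=0\text{ for all }X\in\mathcal X\}$. Theorem. Let $T\in\operatorname{mod}A$ be a support $\tau$-tilting module. Then $(\mathcal C,\mathcal T)=({}^{\perp_1}\operatorname{Gen}T,\operatorname{Gen}T)$ is a left weak cotorsion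 pair in $\operatorname{mod}A$, that is: 1. $\operatorname{Ext}^1_A(X,Y)=0$ for all $X\in\mathcal C$ and $Y\in\mathcal T$; 2. for every $M\in\operatorname{mod}A$ there are exact sequences $$0\to Y_M\to X_M\xrightarrow{f_M}M\to 0\qquad\text{and}\qquad M\xrightarrow{g^M}Y^M\to X^M\to 0$$ with $X_M,X^M\in\mathcal C$ and $Y_M,Y^M\in\mathcal T$, such that $f_M$ is a right $\mathcal C$-approximation of $M$ (every morphism from an object of $\mathcal C$ to $M$ factors through $f_M$) and $g^M$ is a left $\mathcal T$-approximation of $M$ (every morphism from $M$ to an object of $\mathcal T$ factors through $g^M$). -/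

import Mathlib

open CategoryTheory

universe w u

noncomputable section

namespace TauTilting

/-! ### Duals, transposes and the Auslander–Reiten translation -/

/-- The duality `D = Hom_k(-, k)`, from right `A`-modules (i.e. `Aᵐᵒᵖ`-modules) to left
`A`-modules. A type synonym, carrying the left `A`-action `(a • φ) x = φ (x a)`. -/
def KDual (k : Type*) (X : Type*) [Field k] [AddCommGroup X] [Module k X] : Type _ :=
  X →ₗ[k] k

instance KDual.addCommGroup (k : Type*) (X : Type*) [Field k] [AddCommGroup X] [Module k X] :
    AddCommGroup (KDual k X) :=
  inferInstanceAs (AddCommGroup (X →ₗ[k] k))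

instance KDual.module (k : Type*) (A : Type*) (X : Type*) [Field k] [Ring A] [AddCommGroup X]
    [Module k X]
    [Module Aᵐᵒᵖ X] [SMulCommClass Aᵐᵒᵖ k X] : Module A (KDual k X) where
  smul a φ := LinearMap.comp (φ : X →ₗ[k] k) (DistribSMul.toLinearMap k X (MulOpposite.op a))
  one_smul φ := LinearMap.ext fun x => congrArg (DFunLike.coe (F := X →ₗ[k] k) φ) (one_smul _ x)
  mul_smul a b φ := LinearMap.ext fun x =>
    congrArg (DFunLike.coe (F := X →ₗ[k] k) φ) (mul_smul (MulOpposite.op b) (MulOpposite.op a) x)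
  smul_zero _ := rfl
  smul_add _ _ _ := rfl
  add_smul a b φ := LinearMap.ext fun x =>
    (congrArg (DFunLike.coe (F := X →ₗ[k] k) φ)
      (add_smul (MulOpposite.op a) (MulOpposite.op b) x)).trans (LinearMap.map_add _ _ _)
  zero_smul φ := LinearMap.ext fun x =>
    (congrArg (DFunLike.coe (F := X →ₗ[k] k) φ) (zero_smul Aᵐᵒᵖ x)).trans (LinearMap.map_zero _)

section Translate

variable {A : Type u} [Ring A]

/-- A submodule `K` of `P` is superfluous if `N + K = P` only for `N = P`. -/
def IsSuperfluous {P : Type*} [AddCommGroup P] [Module A P] (K : Submodule A P) : Prop :=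
  ∀ N : Submodule A P, N ⊔ K = ⊤ → N = ⊤

/-- `P₁ --d--> P₀ --p--> M → 0` is a minimal projective presentation of `M` by finitely generated
projective modules: it is exact, and `P₀ → M` and `P₁ → im d` are projective covers. -/
structure IsMinimalProjectivePresentation {P₁ P₀ M : Type*} [AddCommGroup P₁] [Module A P₁]
    [AddCommGroup P₀] [Module A P₀] [AddCommGroup M] [Module A M]
    (d : P₁ →ₗ[A] P₀) (p : P₀ →ₗ[A] M) : Prop where
  finite_one : Module.Finite A P₁
  finite_zero : Module.Finite A P₀
  projective_one : Module.Projective A P₁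
  projective_zero : Module.Projective A P₀
  exact : Function.Exact d p
  surjective : Function.Surjective p
  superfluous_zero : IsSuperfluous (LinearMap.ker p)
  superfluous_one : IsSuperfluous (LinearMap.ker d)

/-- The map `Hom_A(d, A) : Hom_A(P₀, A) → Hom_A(P₁, A)` of right `A`-modules. -/
def homDual {P₁ P₀ : Type*} [AddCommGroup P₁] [Module A P₁] [AddCommGroup P₀] [Module A P₀]
    (d : P₁ →ₗ[A] P₀) : (P₀ →ₗ[A] A) →ₗ[Aᵐᵒᵖ] (P₁ →ₗ[A] A) where
  toFun f := f.comp d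
  map_add' _ _ := rfl
  map_smul' _ _ := rfl

/-- The cokernel of `Hom_A(d, A)`, a right `A`-module. If `d` is the first map of a minimal
projective presentation of `M`, this is the transpose `Tr M`. -/
abbrev Transpose {P₁ P₀ : Type*} [AddCommGroup P₁] [Module A P₁] [AddCommGroup P₀] [Module A P₀]
    (d : P₁ →ₗ[A] P₀) : Type _ :=
  (P₁ →ₗ[A] A) ⧸ LinearMap.range (homDual d)

/-- The left `A`-module `D (Coker Hom_A(d, A))`. If `d` is the first map of a minimal
projective presentation of `M`, this is the Auslander–Reiten translate `τ M = D Tr M`. -/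
abbrev ARTranslate (k : Type w) [Field k] [Algebra k A] {P₁ P₀ : Type*} [AddCommGroup P₁]
    [Module A P₁] [AddCommGroup P₀] [Module A P₀] (d : P₁ →ₗ[A] P₀) : Type _ :=
  KDual k (Transpose d)

/-- `Hom_A(M, τ M) = 0`, where `τ M` is computed from a minimal projective presentation of `M`
(which exists and is unique up to isomorphism). -/
def IsTauRigid (k : Type w) [Field k] [Algebra k A] (M : FGModuleCat.{u} A) : Prop :=
  ∃ (P₁ P₀ : FGModuleCat.{u} A) (d : P₁ →ₗ[A] P₀) (p : P₀ →ₗ[A] M),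
    IsMinimalProjectivePresentation d p ∧ ∀ h : M →ₗ[A] ARTranslate k d, h = 0

/-! ### τ-tilting and support τ-tilting modules -/

/-- `M` is nonzero and is not the direct sum of two nonzero submodules. -/
def IsIndecomposable (A : Type*) (M : Type*) [Ring A] [AddCommGroup M] [Module A M] : Prop :=
  Nontrivial M ∧ ∀ N N' : Submodule A M, IsCompl N N' → N = ⊥ ∨ N' = ⊥

/-- `M` has exactly `n` indecomposable direct summands up to isomorphism: `M ≅ ⨁ Nᵢ ^ mᵢ`
with `N₁, …, Nₙ` indecomposable and pairwise non-isomorphic and all `mᵢ > 0`. (By the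
Krull–Schmidt theorem `n` is determined by `M`; `M` is basic if all `mᵢ` are `1`.) -/
def HasIndecomposableSummands (M : FGModuleCat.{u} A) (n : ℕ) : Prop :=
  ∃ (N : Fin n → FGModuleCat.{u} A) (m : Fin n → ℕ),
    (∀ i, IsIndecomposable A (N i)) ∧ (∀ i, 0 < m i) ∧
    (∀ i j, Nonempty (N i ≃ₗ[A] N j) → i = j) ∧
    Nonempty (M ≃ₗ[A] ((i : Fin n) → Fin (m i) → N i))

/-- There are exactly `n` simple `A`-modules up to isomorphism. -/
def HasSimples (A : Type u) [Ring A] (n : ℕ) : Prop :=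
  ∃ S : Fin n → FGModuleCat.{u} A,
    (∀ i, IsSimpleModule A (S i)) ∧
    (∀ i j, Nonempty (S i ≃ₗ[A] S j) → i = j) ∧
    ∀ L : FGModuleCat.{u} A, IsSimpleModule A L → ∃ i, Nonempty (L ≃ₗ[A] S i)

/-- `M` is τ-tilting: `Hom(M, τ M) = 0`, and `M` has as many indecomposable direct summands as
there are simple `A`-modules (both counted up to isomorphism). -/
def IsTauTilting (k : Type w) [Field k] [Algebra k A] (M : FGModuleCat.{u} A) : Prop :=
  IsTauRigid k M ∧ ∃ n : ℕ, HasIndecomposableSummands M n ∧ HasSimples A n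

/-- The two-sided ideal `A e A`. -/
abbrev idealAeA (e : A) : Ideal A := (TwoSidedIdeal.span {e}).asIdeal

/-- `T` is support τ-tilting: for some idempotent `e`, `T` is (the restriction along `A → A / AeA`
of) a τ-tilting `A / AeA`-module. -/
def IsSupportTauTilting (k : Type w) [Field k] [Algebra k A] (T : FGModuleCat.{u} A) : Prop :=
  ∃ e : A, IsIdempotentElem e ∧ ∃ N : FGModuleCat.{u} (A ⧸ idealAeA e),
    IsTauTilting k N ∧
    Nonempty (T.obj ≅ (ModuleCat.restrictScalars (Ideal.Quotient.mk (idealAeA e))).obj N.obj)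

/-! ### Subcategories of `mod A` and left weak cotorsion pairs

A full subcategory of `mod A` is given by a property of the objects of `FGModuleCat A`. -/

/-- `Gen T`: the quotients of finite direct sums of copies of `T`. -/
def Gen (T : FGModuleCat.{u} A) : ObjectProperty (FGModuleCat.{u} A) := fun M =>
  ∃ (n : ℕ) (q : (Fin n → T) →ₗ[A] M), Function.Surjective q

/-- `Ext¹_A(X, Y) = 0`. -/
def ExtVanishes (X Y : FGModuleCat.{u} A) : Prop :=
  Subsingleton (Abelian.Ext X.obj Y.obj 1)

/-- The subcategory `{Y | Ext¹(Y, 𝒳) = 0}`. -/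
def leftExtPerp (𝒳 : ObjectProperty (FGModuleCat.{u} A)) : ObjectProperty (FGModuleCat.{u} A) :=
  fun Y => ∀ X, 𝒳 X → ExtVanishes Y X

/-- `f : X → M` is a right `𝒞`-approximation of `M`. -/
def IsRightApproximation (𝒞 : ObjectProperty (FGModuleCat.{u} A)) {X M : FGModuleCat.{u} A}
    (f : X →ₗ[A] M) : Prop :=
  𝒞 X ∧ ∀ X' : FGModuleCat.{u} A, 𝒞 X' → ∀ h : X' →ₗ[A] M, ∃ h' : X' →ₗ[A] X, f ∘ₗ h' = h

/-- `g : M → Y` is a left `𝒯`-approximation of `M`. -/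
def IsLeftApproximation (𝒯 : ObjectProperty (FGModuleCat.{u} A)) {M Y : FGModuleCat.{u} A}
    (g : M →ₗ[A] Y) : Prop :=
  𝒯 Y ∧ ∀ Y' : FGModuleCat.{u} A, 𝒯 Y' → ∀ h : M →ₗ[A] Y', ∃ h' : Y →ₗ[A] Y', h' ∘ₗ g = h

/-- `(𝒞, 𝒯)` is a left weak cotorsion pair in `mod A`: `Ext¹(𝒞, 𝒯) = 0`, and every `M` has exact
sequences `0 → Y --i--> X --f--> M → 0` and `M --g--> Y' --c--> X' → 0` with `X, X'` in `𝒞` and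
`Y, Y'` in `𝒯`, where `f` is a right `𝒞`-approximation and `g` a left `𝒯`-approximation. -/
structure IsLeftWeakCotorsionPair (𝒞 𝒯 : ObjectProperty (FGModuleCat.{u} A)) : Prop where
  ext_vanishes : ∀ X Y, 𝒞 X → 𝒯 Y → ExtVanishes X Y
  exists_right : ∀ M : FGModuleCat.{u} A, ∃ (Y X : FGModuleCat.{u} A) (i : Y →ₗ[A] X)
    (f : X →ₗ[A] M), 𝒞 X ∧ 𝒯 Y ∧ Function.Injective i ∧ Function.Exact i f ∧
      Function.Surjective f ∧ IsRightApproximation 𝒞 f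
  exists_left : ∀ M : FGModuleCat.{u} A, ∃ (Y X : FGModuleCat.{u} A) (g : M →ₗ[A] Y)
    (c : Y →ₗ[A] X), 𝒞 X ∧ 𝒯 Y ∧ Function.Exact g c ∧
      Function.Surjective c ∧ IsLeftApproximation 𝒯 g

end Translate

end TauTilting

end

/-! Everything rests on `Ext¹(T, Gen T) = 0` (`IsSupportTauTilting.extZero`). Put `B = A / AeA` and
let `P₁ → P₀ → N → 0` be the presentation over `B`. By `k`-duality, `Hom_B(N, τN) = 0` forces every
map `P₁ → N` to extend along `d`; projectivity of `P₁` passes this on to quotients `Z` of `Nⁿ`. As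
`AeA` is an idempotent ideal, `Ext¹_A(P₀, Z) = 0` although `P₀` need not be projective over `A`, so
`Ext¹_A(N, Z) = 0`. Both sequences then come from pushouts along a map `g` from a free module to
some `Tⁿ` through which all maps to `Gen T` factor (`exists_approximation`). `ExtZero.of_exact` puts
the resulting cokernels in the left perpendicular class. -/

noncomputable section

namespace TauTilting

open Abelian

/-! ### Vanishing criteria for `Ext¹` -/

section Ext

variable {A : Type u} [Ring A]

/-- `Ext¹_A(X, Z) = 0`, for unbundled modules. -/
abbrev ExtZero (A : Type u) [Ring A] (X Z : Type u) [AddCommGroup X] [Module A X]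
    [AddCommGroup Z] [Module A Z] : Prop :=
  Subsingleton (Ext (ModuleCat.of A X) (ModuleCat.of A Z) 1)

variable {X Z : Type u} [AddCommGroup X] [Module A X] [AddCommGroup Z] [Module A Z]

theorem ExtZero.of_projective [Module.Projective A X] : ExtZero A X Z :=
  Ext.subsingleton_of_projective _ _ 0

/-- `Ext¹(X, Z)` vanishes as soon as the identity of `X` is a sum of maps factoring through
modules `W i` with `Ext¹(W i, Z) = 0`. -/
theorem ExtZero.of_sum_comp_eq_id {ι : Type*} [Fintype ι] {W : ι → Type u}
    [∀ i, AddCommGroup (W i)] [∀ i, Module A (W i)] (a : ∀ i, X →ₗ[A] W i) (b : ∀ i, W i →ₗ[A] X)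
    (hab : ∑ i, b i ∘ₗ a i = LinearMap.id) (hW : ∀ i, ExtZero A (W i) Z) : ExtZero A X Z := by
  refine subsingleton_of_forall_eq 0 fun x => ?_
  have hid : 𝟙 (ModuleCat.of A X) =
      ∑ i, ModuleCat.ofHom (a i) ≫ ModuleCat.ofHom (b i) := by
    ext1
    rw [ModuleCat.hom_sum, ModuleCat.hom_id]
    exact hab.symm
  rw [← Ext.mk₀_id_comp x, hid, Ext.mk₀_sum, Ext.sum_comp]
  refine Finset.sum_eq_zero fun i _ => ?_
  rw [← Ext.mk₀_comp_mk₀_assoc, (hW i).elim ((Ext.mk₀ (ModuleCat.ofHom (b i))).comp x _) 0,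
    Ext.comp_zero]

theorem ExtZero.of_retract {W : Type u} [AddCommGroup W] [Module A W] (a : X →ₗ[A] W)
    (b : W →ₗ[A] X) (hab : b ∘ₗ a = LinearMap.id) (hW : ExtZero A W Z) : ExtZero A X Z :=
  .of_sum_comp_eq_id (ι := Unit) (W := fun _ => W) (fun _ => a) (fun _ => b) (by simpa using hab)
    fun _ => hW

theorem ExtZero.pi (hX : ExtZero A X Z) (n : ℕ) : ExtZero A (Fin n → X) Z :=
  .of_sum_comp_eq_id (W := fun _ : Fin n => X) (fun i => LinearMap.proj i)
    (fun i => LinearMap.single A (fun _ => X) i)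
    (by
      refine LinearMap.ext fun x => ?_
      simp [LinearMap.sum_apply, Finset.univ_sum_single]) fun _ => hX

theorem ExtZero.prod {W : Type u} [AddCommGroup W] [Module A W] (hX : ExtZero A X Z)
    (hW : ExtZero A W Z) : ExtZero A (X × W) Z := by
  refine subsingleton_of_forall_eq 0 fun x => ?_
  have hid : 𝟙 (ModuleCat.of A (X × W)) =
      ModuleCat.ofHom (LinearMap.fst A X W) ≫ ModuleCat.ofHom (LinearMap.inl A X W) +
      ModuleCat.ofHom (LinearMap.snd A X W) ≫ ModuleCat.ofHom (LinearMap.inr A X W) := by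
    ext x <;> simp
  rw [← Ext.mk₀_id_comp x, hid, Ext.mk₀_add, Ext.add_comp, ← Ext.mk₀_comp_mk₀_assoc,
    ← Ext.mk₀_comp_mk₀_assoc,
    hX.elim ((Ext.mk₀ (ModuleCat.ofHom (LinearMap.inl A X W))).comp x _) 0,
    hW.elim ((Ext.mk₀ (ModuleCat.ofHom (LinearMap.inr A X W))).comp x _) 0,
    Ext.comp_zero, Ext.comp_zero, add_zero]

/-- If `P → W → X → 0` is exact, `Ext¹(W, Z) = 0` and every map `P → Z` extends to `W`, then
`Ext¹(X, Z) = 0`. -/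
theorem ExtZero.of_exact {P : Type*} {W : Type u} [AddCommGroup P] [Module A P] [AddCommGroup W]
    [Module A W] (hW : ExtZero A W Z) (u : P →ₗ[A] W) (q : W →ₗ[A] X) (hq : Function.Surjective q)
    (huq : Function.Exact u q) (hext : ∀ b : P →ₗ[A] Z, ∃ c : W →ₗ[A] Z, c ∘ₗ u = b) :
    ExtZero A X Z := by
  refine subsingleton_of_forall_eq 0 fun x => ?_
  have hS := LinearMap.shortExact_shortComplexKer hq
  -- Since `x` dies in `Ext¹(W, Z) = 0`, it is the image of some `f : ker q → Z` under the
  -- connecting map. Extending `f ∘ u` to `W` extends `f`, as `u` maps onto `ker q`, so that image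
  -- is zero.
  obtain ⟨y, hy⟩ := Ext.contravariant_sequence_exact₃ hS (ModuleCat.of A Z) x
    (hW.elim _ _) (n₀ := 0) rfl
  obtain ⟨f, rfl⟩ := (Ext.mk₀_bijective _ _).2 y
  have hu : ∀ p, u p ∈ LinearMap.ker q := fun p => huq.apply_apply_eq_zero p
  obtain ⟨c, hc⟩ := hext (f.hom ∘ₗ u.codRestrict _ hu)
  have hf : f = q.shortComplexKer.f ≫ ModuleCat.ofHom c := by
    ext ⟨w, hw⟩
    obtain ⟨p, rfl⟩ := (huq w).1 hw
    exact (LinearMap.congr_fun hc p).symm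
  rw [← hy, hf, ← Ext.mk₀_comp_mk₀, hS.extClass_comp_assoc]

/-- Maps out of `X` lift along a surjection whose kernel `Z` satisfies `Ext¹(X, Z) = 0`. -/
theorem ExtZero.exists_lift {E M : Type u} [AddCommGroup E] [Module A E] [AddCommGroup M]
    [Module A M] (f : E →ₗ[A] M) (hf : Function.Surjective f)
    (hX : ExtZero A X (LinearMap.ker f)) (h : X →ₗ[A] M) : ∃ h' : X →ₗ[A] E, f ∘ₗ h' = h := by
  have hS := LinearMap.shortExact_shortComplexKer hf
  obtain ⟨y, hy⟩ := Ext.covariant_sequence_exact₃ (ModuleCat.of A X) hS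
    (Ext.mk₀ (ModuleCat.ofHom h)) (n₁ := 1) rfl (hX.elim _ _)
  obtain ⟨g, rfl⟩ := (Ext.mk₀_bijective _ _).2 y
  rw [Ext.mk₀_comp_mk₀] at hy
  exact ⟨g.hom, congrArg ModuleCat.Hom.hom ((Ext.mk₀_bijective _ _).1 hy)⟩

end Ext

/-! ### Extending maps when `Hom(N, τ) = 0` -/

section Translate

variable {k : Type w} [Field k] {A : Type u} [Ring A] [Algebra k A]
variable {P₁ P₀ N : Type*} [AddCommGroup P₁] [Module A P₁] [AddCommGroup P₀] [Module A P₀]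
  [AddCommGroup N] [Module A N] [Module k N] [IsScalarTower k A N] [SMulCommClass A k N]

/-- The map `Hom_A(P, A) → Hom_A(P, N)`, `φ ↦ φ(-) • t`. -/
def homSMul (k : Type w) [Field k] [Algebra k A] [Module k N] [IsScalarTower k A N]
    [SMulCommClass A k N] (P₁ : Type*) [AddCommGroup P₁] [Module A P₁] (t : N) :
    (P₁ →ₗ[A] A) →ₗ[k] (P₁ →ₗ[A] N) where
  toFun φ := φ.smulRight t
  map_add' φ ψ := by ext; simp [add_smul]
  map_smul' c φ := by ext; simp

/-- The map `N → τ` attached to a functional on `Hom_A(P₁, N)` that vanishes on the image of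
`Hom_A(P₀, N)`. -/
def toARTranslate (d : P₁ →ₗ[A] P₀) (l : (P₁ →ₗ[A] N) →ₗ[k] k)
    (hl : ∀ f : P₀ →ₗ[A] N, l (f ∘ₗ d) = 0) : N →ₗ[A] ARTranslate k d where
  -- The element `t` goes to the functional `φ ↦ l (φ(-) • t)`, which kills each `ψ ∘ d` because `(ψ
  -- ∘ d)(-) • t` is `ψ(-) • t` composed with `d`.
  toFun t := (((LinearMap.range (homDual d)).restrictScalars k).liftQ (l ∘ₗ homSMul k P₁ t) (by
      rintro _ ⟨ψ, rfl⟩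
      exact hl (ψ.smulRight t))) ∘ₗ
    (Submodule.Quotient.restrictScalarsEquiv k (LinearMap.range (homDual d))).symm.toLinearMap
  map_add' s t := by
    refine LinearMap.ext fun x => ?_
    obtain ⟨φ, rfl⟩ := Submodule.Quotient.mk_surjective _ x
    change l (φ.smulRight (s + t)) = l (φ.smulRight s) + l (φ.smulRight t)
    rw [← map_add]
    congr 1
    ext p
    simp
  map_smul' a t := by
    refine LinearMap.ext fun x => ?_
    obtain ⟨φ, rfl⟩ := Submodule.Quotient.mk_surjective _ x
    change l (φ.smulRight (a • t)) = l ((MulOpposite.op a • φ).smulRight t)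
    congr 1
    ext p
    simp [mul_smul]

/-- A finitely generated projective module has a finite dual basis. -/
theorem exists_dualBasis (A P : Type*) [Ring A] [AddCommGroup P] [Module A P] [Module.Finite A P]
    [Module.Projective A P] :
    ∃ (n : ℕ) (φ : Fin n → (P →ₗ[A] A)) (e : Fin n → P), ∀ x, ∑ i, φ i x • e i = x := by
  obtain ⟨n, f, g, -, -, hfg⟩ := Module.Finite.exists_comp_eq_id_of_projective A P
  refine ⟨n, fun i => LinearMap.proj i ∘ₗ g, fun i => f (Pi.single i 1), fun x => ?_⟩
  conv_rhs => rw [← LinearMap.id_apply (R := A) x, ← hfg, LinearMap.comp_apply,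
    pi_eq_sum_univ' (g x), map_sum]
  refine Finset.sum_congr rfl fun i _ => ?_
  rw [map_smul]
  rfl

/-- If `Hom_A(N, D Coker Hom_A(d, A)) = 0`, every map `P₁ → N` extends along `d : P₁ → P₀`. -/
theorem exists_extension_of_hom_ARTranslate_eq_zero [Module.Finite A P₁] [Module.Projective A P₁]
    (d : P₁ →ₗ[A] P₀) (h : ∀ h : N →ₗ[A] ARTranslate k d, h = 0) (f : P₁ →ₗ[A] N) :
    ∃ g : P₀ →ₗ[A] N, g ∘ₗ d = f := by
  let r : (P₀ →ₗ[A] N) →ₗ[k] (P₁ →ₗ[A] N) :=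
    { toFun := fun g => g ∘ₗ d, map_add' := fun _ _ => rfl, map_smul' := fun _ _ => rfl }
  suffices hf : f ∈ LinearMap.range r from hf
  by_contra hf
  -- A functional separating `f` from the maps that extend induces a map `N → τ`, which is zero.
  -- Hence `l` kills all `ψ(-) • t`, and by the dual basis `f` is a sum of these.
  obtain ⟨l, hlf, hl⟩ := Submodule.exists_le_ker_of_notMem hf
  obtain ⟨n, φ, e, he⟩ := exists_dualBasis A P₁
  have hz := h (toARTranslate d l fun g => hl ⟨g, rfl⟩)
  have hl0 : ∀ (ψ : P₁ →ₗ[A] A) (t : N), l (ψ.smulRight t) = 0 := fun ψ t =>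
    congrArg (fun ξ : ARTranslate k d => (show Transpose d →ₗ[k] k from ξ)
      (Submodule.Quotient.mk ψ)) (LinearMap.congr_fun hz t)
  have hsum : f = ∑ i, (φ i).smulRight (f (e i)) := by
    ext x
    conv_lhs => rw [← he x]
    simp [LinearMap.sum_apply]
  apply hlf
  rw [hsum, map_sum]
  exact Finset.sum_eq_zero fun i _ => hl0 _ _

end Translate

/-! ### Comparing `A` with `A / AeA` -/

section Quotient

variable {A : Type u} [Ring A]

theorem mem_idealAeA_self (e : A) : e ∈ idealAeA e :=
  TwoSidedIdeal.mem_asIdeal.2 (TwoSidedIdeal.subset_span (Set.mem_singleton e))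

open scoped Pointwise in
/-- A linear map from `A e A` to a module killed by `e` vanishes. -/
theorem linearMap_idealAeA_eq_zero {e : A} (he : IsIdempotentElem e) {Z : Type*} [AddCommGroup Z]
    [Module A Z] (hZ : ∀ z : Z, e • z = 0) (b : idealAeA e →ₗ[A] Z) : b = 0 := by
  have key : ∀ x ∈ idealAeA e, ∀ hx : x ∈ idealAeA e, b ⟨x, hx⟩ = 0 := by
    intro x hx
    have hx' := TwoSidedIdeal.mem_span_iff_mem_addSubgroup_closure.1
      (TwoSidedIdeal.mem_asIdeal.1 hx)
    have hle : AddSubgroup.closure ((Set.univ : Set A) * ({e} : Set A) * (Set.univ : Set A)) ≤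
        ((LinearMap.ker b).map (idealAeA e).subtype).toAddSubgroup := by
      rw [AddSubgroup.closure_le]
      rintro _ ⟨_, ⟨a, -, e', he', rfl⟩, c, -, rfl⟩
      rw [Set.mem_singleton_iff.1 he']
      have hec : e * c ∈ idealAeA e := Ideal.mul_mem_right c _ (mem_idealAeA_self e)
      -- Idempotence gives `aec = (ae)(ec)` with `ec` in `AeA`, so the value of `b` is `a • e •
      -- b(ec) = 0`.
      refine ⟨(a * e) • ⟨e * c, hec⟩, ?_, ?_⟩
      · change b _ = 0
        rw [map_smul, mul_smul, hZ, smul_zero]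
      · change a * e * (e * c) = a * e * c
        rw [← mul_assoc, mul_assoc a e e, he.eq]
    obtain ⟨⟨y, hy⟩, hby, rfl⟩ := hle hx'
    exact fun _ => hby
  exact LinearMap.ext fun x => key x x.2 x.2

/-- In `0 → AeA → A → A/AeA → 0` the middle term is projective and `Hom(AeA, Z) = 0`. -/
theorem extZero_quotient_idealAeA {e : A} (he : IsIdempotentElem e) {Z : Type u} [AddCommGroup Z]
    [Module A Z] (hZ : ∀ z : Z, e • z = 0) : ExtZero A (A ⧸ idealAeA e) Z :=
  (ExtZero.of_projective (X := A)).of_exact (idealAeA e).subtype (idealAeA e).mkQ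
    (Submodule.mkQ_surjective _) (LinearMap.exact_subtype_mkQ _)
    fun b => ⟨0, by rw [linearMap_idealAeA_eq_zero he hZ b, LinearMap.zero_comp]⟩

/-- `Ext¹_A` vanishes from projective `A / AeA`-modules to modules killed by `e`. -/
theorem extZero_of_projective_quotient {e : A} (he : IsIdempotentElem e) {Z : Type u}
    [AddCommGroup Z] [Module A Z] (hZ : ∀ z : Z, e • z = 0) {Q : Type u} [AddCommGroup Q]
    [Module A Q] [Module (A ⧸ idealAeA e) Q] [IsScalarTower A (A ⧸ idealAeA e) Q]
    [Module.Finite (A ⧸ idealAeA e) Q] [Module.Projective (A ⧸ idealAeA e) Q] :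
    ExtZero A Q Z := by
  obtain ⟨n, φ, x, hx⟩ := exists_dualBasis (A ⧸ idealAeA e) Q
  refine .of_sum_comp_eq_id (W := fun _ : Fin n => A ⧸ idealAeA e)
    (fun i => (φ i).restrictScalars A)
    (fun i => (LinearMap.toSpanSingleton (A ⧸ idealAeA e) Q (x i)).restrictScalars A) ?_
    fun _ => extZero_quotient_idealAeA he hZ
  ext y
  simpa [LinearMap.sum_apply] using hx y

theorem quotient_mk_smul {I : Ideal A} [I.IsTwoSided] {L : Type*} [AddCommGroup L] [Module A L]
    [Module (A ⧸ I) L] [IsScalarTower A (A ⧸ I) L] (a : A) (z : L) :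
    Ideal.Quotient.mk I a • z = a • z := by
  have h : Ideal.Quotient.mk I a = a • (1 : A ⧸ I) := by
    conv_lhs => rw [← mul_one a]
    rfl
  rw [h, smul_assoc, one_smul]

theorem isScalarTower_compHom_mk (I : Ideal A) [I.IsTwoSided] (L : Type*) [AddCommGroup L]
    [Module (A ⧸ I) L] :
    letI : Module A L := Module.compHom L (Ideal.Quotient.mk I)
    IsScalarTower A (A ⧸ I) L := by
  let : Module A L := Module.compHom L (Ideal.Quotient.mk I)
  refine ⟨fun a b z => ?_⟩
  obtain ⟨b, rfl⟩ := Ideal.Quotient.mk_surjective b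
  exact mul_smul (Ideal.Quotient.mk I a) (Ideal.Quotient.mk I b) z

/-- An `A`-linear map from a finitely generated projective `A / I`-module to an `A`-module lifts,
`A / I`-linearly, along any surjection from an `A / I`-module. -/
theorem exists_lift_of_projective_quotient {I : Ideal A} [I.IsTwoSided] {P N Z : Type*}
    [AddCommGroup P] [Module A P] [Module (A ⧸ I) P] [IsScalarTower A (A ⧸ I) P]
    [Module.Finite (A ⧸ I) P] [Module.Projective (A ⧸ I) P]
    [AddCommGroup N] [Module A N] [Module (A ⧸ I) N] [IsScalarTower A (A ⧸ I) N]
    [AddCommGroup Z] [Module A Z] (q : N →ₗ[A] Z) (hq : Function.Surjective q) (f : P →ₗ[A] Z) :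
    ∃ g : P →ₗ[A ⧸ I] N, q ∘ₗ g.restrictScalars A = f := by
  obtain ⟨n, φ, x, hx⟩ := exists_dualBasis (A ⧸ I) P
  choose t ht using fun i => hq (f (x i))
  refine ⟨∑ i, (φ i).smulRight (t i), ?_⟩
  ext y
  conv_rhs => rw [← hx y]
  rw [LinearMap.comp_apply, LinearMap.restrictScalars_apply, LinearMap.sum_apply, map_sum, map_sum]
  refine Finset.sum_congr rfl fun i _ => ?_
  obtain ⟨a, ha⟩ := Ideal.Quotient.mk_surjective (φ i y)
  change q (φ i y • t i) = f (φ i y • x i)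
  rw [← ha, quotient_mk_smul, quotient_mk_smul, map_smul, map_smul, ht]

/-- If `N` is a τ-rigid `A / AeA`-module, then `Ext¹_A(N, Z) = 0` for all `A`-modules `Z`
generated by `N`. -/
theorem extZero_of_isTauRigid {k : Type w} [Field k] [Algebra k A] {e : A}
    (he : IsIdempotentElem e) {N : FGModuleCat.{u} (A ⧸ idealAeA e)} (hN : IsTauRigid k N)
    [Module A N] [IsScalarTower A (A ⧸ idealAeA e) N] {Z : Type u} [AddCommGroup Z] [Module A Z]
    {n : ℕ} (q : (Fin n → N) →ₗ[A] Z) (hq : Function.Surjective q) : ExtZero A N Z := by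
  obtain ⟨P₁, P₀, d, p, hmin, hτ⟩ := hN
  have := hmin.projective_zero
  have := hmin.projective_one
  let : Module A P₁ := Module.compHom P₁ (Ideal.Quotient.mk (idealAeA e))
  have : IsScalarTower A (A ⧸ idealAeA e) P₁ := isScalarTower_compHom_mk _ _
  let : Module A P₀ := Module.compHom P₀ (Ideal.Quotient.mk (idealAeA e))
  have : IsScalarTower A (A ⧸ idealAeA e) P₀ := isScalarTower_compHom_mk _ _
  let : Module k N := Module.compHom N (algebraMap k (A ⧸ idealAeA e))
  have : IsScalarTower k (A ⧸ idealAeA e) N :=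
    .of_algebraMap_smul fun _ _ => rfl
  have : SMulCommClass (A ⧸ idealAeA e) k N := IsScalarTower.to_smulCommClass'
  have heN : ∀ x : N, e • x = 0 := fun x => by
    rw [← quotient_mk_smul (I := idealAeA e),
      Ideal.Quotient.eq_zero_iff_mem.2 (mem_idealAeA_self e), zero_smul]
  have heZ : ∀ z : Z, e • z = 0 := fun z => by
    obtain ⟨x, rfl⟩ := hq z
    rw [← map_smul, show e • x = 0 from funext fun i => heN (x i), map_zero]
  refine (extZero_of_projective_quotient he heZ (Q := P₀)).of_exact (d.restrictScalars A)
    (p.restrictScalars A) hmin.surjective hmin.exact fun b => ?_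
  -- Lift `b` to `Nⁿ`, then extend each component along `d`.
  obtain ⟨g, rfl⟩ := exists_lift_of_projective_quotient (I := idealAeA e) q hq b
  choose c hc using fun i => exists_extension_of_hom_ARTranslate_eq_zero d hτ (LinearMap.proj i ∘ₗ g)
  refine ⟨q ∘ₗ (LinearMap.pi c).restrictScalars A, ?_⟩
  ext x
  change q _ = q _
  congr 1
  ext i
  exact LinearMap.congr_fun (hc i) x

end Quotient

/-! ### Construction of the approximations -/

section Approximation

variable {A : Type u} [Ring A]

/-- A finite-dimensional projective module `P` maps to some `Tⁿ` in such a way that all maps from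
`P` to modules in `Gen T` factor. -/
theorem exists_approximation {k : Type w} [Field k] [Algebra k A] [FiniteDimensional k A]
    (T : FGModuleCat.{u} A) (P : Type u) [AddCommGroup P] [Module A P] [Module.Finite A P]
    [Module.Projective A P] :
    ∃ (n : ℕ) (g : P →ₗ[A] (Fin n → T)), ∀ Z : FGModuleCat.{u} A, Gen T Z →
      ∀ b : P →ₗ[A] Z, ∃ c : (Fin n → T) →ₗ[A] Z, c ∘ₗ g = b := by
  let : Module k T := Module.compHom T (algebraMap k A)
  have : IsScalarTower k A T := .of_algebraMap_smul fun _ _ => rfl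
  have : SMulCommClass A k T := IsScalarTower.to_smulCommClass'
  let : Module k P := Module.compHom P (algebraMap k A)
  have : IsScalarTower k A P := .of_algebraMap_smul fun _ _ => rfl
  have : Module.Finite k T := .trans A T
  have : Module.Finite k P := .trans A P
  let ρ : (P →ₗ[A] T) →ₗ[k] (P →ₗ[k] T) :=
    { toFun := fun f => f.restrictScalars k, map_add' := fun _ _ => rfl,
      map_smul' := fun _ _ => rfl }
  have : Module.Finite k (P →ₗ[A] T) :=
    .of_injective ρ fun _ _ h => LinearMap.restrictScalars_injective k h
  -- The components of `g` are `k`-generators of `Hom_A(P, T)`.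
  obtain ⟨n, s, hs⟩ := Module.Finite.exists_fin (R := k) (M := P →ₗ[A] T)
  have hT : ∀ f : P →ₗ[A] T, ∃ c : (Fin n → T) →ₗ[A] T, c ∘ₗ LinearMap.pi s = f := by
    intro f
    obtain ⟨c, rfl⟩ := (Submodule.mem_span_range_iff_exists_fun k).1 (hs ▸ Submodule.mem_top : f ∈ _)
    refine ⟨∑ i, c i • LinearMap.proj i, ?_⟩
    ext x
    simp [LinearMap.sum_apply]
  refine ⟨n, LinearMap.pi s, ?_⟩
  rintro Z ⟨m, q, hq⟩ b
  obtain ⟨g, rfl⟩ := Module.projective_lifting_property q b hq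
  choose c hc using fun i => hT (LinearMap.proj i ∘ₗ g)
  refine ⟨q ∘ₗ LinearMap.pi c, ?_⟩
  ext x
  change q _ = q _
  congr 1
  ext i
  exact LinearMap.congr_fun (hc i) x

theorem gen_of_surjective {T : FGModuleCat.{u} A} {n : ℕ} {Y : Type u} [AddCommGroup Y]
    [Module A Y] [Module.Finite A Y] (q : (Fin n → T) →ₗ[A] Y) (hq : Function.Surjective q) :
    Gen T (FGModuleCat.of A Y) :=
  ⟨n, q, hq⟩

variable {T : FGModuleCat.{u} A}

/-- The exact sequence `M → Y → X → 0` for a module `T` with `Ext¹(T, Gen T) = 0`. -/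
theorem exists_left_approximation (k : Type w) [Field k] [Algebra k A] [FiniteDimensional k A]
    (hT : ∀ Z, Gen T Z → ExtZero A T Z) (M : FGModuleCat.{u} A) :
    ∃ (Y X : FGModuleCat.{u} A) (g : M →ₗ[A] Y) (c : Y →ₗ[A] X), leftExtPerp (Gen T) X ∧
      Gen T Y ∧ Function.Exact g c ∧ Function.Surjective c ∧ IsLeftApproximation (Gen T) g := by
  obtain ⟨m, π, hπ⟩ := Module.Finite.exists_fin' A M
  obtain ⟨n, g, hg⟩ := exists_approximation (k := k) T (Fin m → A)
  -- `Tⁿ / K` is the pushout of `g` along `π`, so `f` has the same cokernel as `g`.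
  let K : Submodule A (Fin n → T) := (LinearMap.ker π).map g
  let f : M →ₗ[A] ((Fin n → T) ⧸ K) :=
    (LinearMap.ker π).liftQ (K.mkQ ∘ₗ g) (fun x hx =>
      (Submodule.Quotient.mk_eq_zero K).2 ⟨x, hx, rfl⟩) ∘ₗ
      (π.quotKerEquivOfSurjective hπ).symm.toLinearMap
  have hf : ∀ x, f (π x) = K.mkQ (g x) := by
    intro x
    have : (π.quotKerEquivOfSurjective hπ).symm (π x) = (LinearMap.ker π).mkQ x := by
      rw [LinearEquiv.symm_apply_eq]
      rfl
    rw [LinearMap.comp_apply, LinearEquiv.coe_coe, this]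
    rfl
  refine ⟨FGModuleCat.of A ((Fin n → T) ⧸ K),
    FGModuleCat.of A (((Fin n → T) ⧸ K) ⧸ LinearMap.range f), f, (LinearMap.range f).mkQ, ?_,
    gen_of_surjective K.mkQ K.mkQ_surjective, LinearMap.exact_map_mkQ_range f,
    Submodule.mkQ_surjective _, gen_of_surjective K.mkQ K.mkQ_surjective, ?_⟩
  · intro Z hZ
    refine ((hT Z hZ).pi n).of_exact g ((LinearMap.range f).mkQ ∘ₗ K.mkQ)
      ((Submodule.mkQ_surjective _).comp K.mkQ_surjective) (fun y => ⟨fun hy => ?_, ?_⟩) (hg Z hZ)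
    · obtain ⟨x, hx⟩ := (Submodule.Quotient.mk_eq_zero (LinearMap.range f)).1 hy
      obtain ⟨x, rfl⟩ := hπ x
      rw [hf] at hx
      obtain ⟨z, -, hz⟩ := (Submodule.Quotient.eq K).1 hx
      refine ⟨x - z, ?_⟩
      rw [map_sub, hz, sub_sub_cancel]
    · rintro ⟨x, rfl⟩
      exact (Submodule.Quotient.mk_eq_zero (LinearMap.range f)).2 ⟨π x, hf x⟩
  · intro Y' hY' h
    obtain ⟨c, hc⟩ := hg Y' hY' (h ∘ₗ π)
    refine ⟨K.liftQ c ?_, ?_⟩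
    · rintro _ ⟨x, hx, rfl⟩
      have := LinearMap.congr_fun hc x
      rw [LinearMap.mem_ker]
      rw [LinearMap.comp_apply, LinearMap.comp_apply, LinearMap.mem_ker.1 hx, map_zero] at this
      exact this
    · ext y
      obtain ⟨x, rfl⟩ := hπ y
      rw [LinearMap.comp_apply, hf]
      exact LinearMap.congr_fun hc x

/-- The exact sequence `0 → Y → X → M → 0` for a module `T` with `Ext¹(T, Gen T) = 0`. -/
theorem exists_right_approximation (k : Type w) [Field k] [Algebra k A] [FiniteDimensional k A]
    (hT : ∀ Z, Gen T Z → ExtZero A T Z) (M : FGModuleCat.{u} A) :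
    ∃ (Y X : FGModuleCat.{u} A) (i : Y →ₗ[A] X) (f : X →ₗ[A] M), leftExtPerp (Gen T) X ∧
      Gen T Y ∧ Function.Injective i ∧ Function.Exact i f ∧ Function.Surjective f ∧
      IsRightApproximation (leftExtPerp (Gen T)) f := by
  have : IsNoetherianRing A := .of_finite k A
  obtain ⟨m, π, hπ⟩ := Module.Finite.exists_fin' A M
  obtain ⟨r, δ, hδ⟩ := Module.Finite.exists_fin' A (LinearMap.ker π)
  obtain ⟨n, g, hg⟩ := exists_approximation (k := k) T (Fin r → A)
  -- The cokernel of `u` is the pushout of `ker π ⊆ Aᵐ` and `g`, with `ker π` covered by the free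
  -- module `Aʳ`; the kernel of its map to `M` is a quotient of `Tⁿ`.
  let u : (Fin r → A) →ₗ[A] (Fin m → A) × (Fin n → T) :=
    ((LinearMap.ker π).subtype ∘ₗ δ).prod g
  let U := LinearMap.range u
  let f : (((Fin m → A) × (Fin n → T)) ⧸ U) →ₗ[A] M :=
    U.liftQ (π ∘ₗ LinearMap.fst A _ _) (by
      rintro _ ⟨x, rfl⟩
      exact (δ x).2)
  have hf : Function.Surjective f := fun y => by
    obtain ⟨x, rfl⟩ := hπ y
    exact ⟨U.mkQ (x, 0), rfl⟩
  let j : (Fin n → T) →ₗ[A] LinearMap.ker f :=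
    (U.mkQ ∘ₗ LinearMap.inr A _ _).codRestrict _ fun y => map_zero π
  have hj : Function.Surjective j := by
    rintro ⟨z, hz⟩
    obtain ⟨⟨p, y⟩, rfl⟩ := U.mkQ_surjective z
    obtain ⟨x, hx⟩ := hδ ⟨p, hz⟩
    -- With `δ x = p`, subtracting `u x` moves `(p, y)` to `(0, y - g x)`.
    refine ⟨y - g x, Subtype.ext ((Submodule.Quotient.eq U).2 ⟨-x, ?_⟩)⟩
    rw [map_neg]
    refine Prod.ext ?_ ?_
    · change -((δ x : Fin m → A)) = 0 - p
      rw [hx, zero_sub]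
    · change -(g x) = y - g x - y
      abel
  have hY : Gen T (FGModuleCat.of A (LinearMap.ker f)) := gen_of_surjective j hj
  have hX : leftExtPerp (Gen T) (FGModuleCat.of A (((Fin m → A) × (Fin n → T)) ⧸ U)) := by
    intro Z hZ
    refine (ExtZero.of_projective.prod ((hT Z hZ).pi n)).of_exact u U.mkQ U.mkQ_surjective
      (LinearMap.exact_map_mkQ_range u) fun b => ?_
    obtain ⟨c, hc⟩ := hg Z hZ b
    exact ⟨c ∘ₗ LinearMap.snd A _ _, hc⟩
  exact ⟨FGModuleCat.of A (LinearMap.ker f), FGModuleCat.of A (((Fin m → A) × (Fin n → T)) ⧸ U),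
    (LinearMap.ker f).subtype, f, hX, hY, Subtype.val_injective, LinearMap.exact_subtype_ker_map f,
    hf, hX, fun X' hX' h => ExtZero.exists_lift f hf (hX' _ hY) h⟩

/-- A support τ-tilting module `T` satisfies `Ext¹(T, Gen T) = 0`. -/
theorem IsSupportTauTilting.extZero {k : Type w} [Field k] [Algebra k A]
    (hT : IsSupportTauTilting k T) (Z : FGModuleCat.{u} A) (hZ : Gen T Z) : ExtZero A T Z := by
  obtain ⟨e, he, N, ⟨hN, -⟩, ⟨φ⟩⟩ := hT
  obtain ⟨n, q, hq⟩ := hZ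
  let : Module A N := Module.compHom N (Ideal.Quotient.mk (idealAeA e))
  have : IsScalarTower A (A ⧸ idealAeA e) N := isScalarTower_compHom_mk _ _
  let ψ : T ≃ₗ[A] N := φ.toLinearEquiv
  refine .of_retract ψ.toLinearMap ψ.symm.toLinearMap (by ext; simp) ?_
  exact extZero_of_isTauRigid he hN
    (q ∘ₗ (LinearEquiv.piCongrRight fun _ : Fin n => ψ.symm).toLinearMap)
    (hq.comp (LinearEquiv.surjective _))

end Approximation

end TauTilting

end

theorem mainTheorem2 {k : Type w} {A : Type u} [Field k] [Ring A] [Algebra k A]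
    [FiniteDimensional k A] (T : FGModuleCat.{u} A)
    (hT : TauTilting.IsSupportTauTilting k T) :
    TauTilting.IsLeftWeakCotorsionPair
      (TauTilting.leftExtPerp (TauTilting.Gen T)) (TauTilting.Gen T) := by
  exact
    { ext_vanishes := fun _ Y hX hY => hX Y hY
      exists_right := TauTilting.exists_right_approximation k hT.extZero
      exists_left := TauTilting.exists_left_approximation k hT.extZero }
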